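/- Let $\ell$ be a prime, let $F$ be a field of characteristic different from $2$ and from $\ell$ (for instance a global field), and let $F^{\rm sep}$ be a separable closure of $F$. Let $d \in F^{\times}$ and let $A : x^{2} - dy^{2} = 1$ be the associated one-dimensional torus over $F$, with group law $$(x_1,y_1)+(x_2,y_2) = (x_1x_2 + d\,y_1y_2,\; x_1y_2 + x_2y_1).$$ Write $F(A[m])$ for the field generated over $F$ by the coordinates of the points of $A(F^{\rm sep})$ killed by $m$, put $T_\infty = \bigcup_{n} F(A[\ell^{n}])$, and let $T_\ell(A) = \varprojlim A[\ell^{n}] \cong \mathbb{Z}_\ell$ be the Tate module. Assume that the $\ell$-adic representation $\rho : \mathrm{Gal}(F^{\rm sep}/F) \to \mathrm{Aut}(T_\ell(A)) \cong \mathbb{Z}_\ell^{\times}$ is surjective. Let $\alpha \in A(F)$, and let $\beta_0 = \alpha, \beta_1, \beta_2, \dots$ be any choice of points of $A(F^{\rm sep})$ with $\ell\beta_{n} = \beta_{n-1}$ for all $n \ge 1$. Then the Kummer map $$\kappa : \mathrm{Gal}(F^{\rm sep}/T_\infty) \to T_\ell(A) \cong \mathbb{Z}_\ell, \qquad \sigma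 \mapsto (\sigma(\beta_n) - \beta_n)_{n},$$ is surjective if and only if both of the following hold: 1. $\alpha \notin \ell A(F)$; 2. if $\ell = 2$, then $F(\beta_1) \not\subseteq F(A[8])$. -/

import Mathlib

/-- The `R`-points of the affine curve `A : x ^ 2 - d * y ^ 2 = 1` over `F`, for a commutative
`F`-algebra `R`. -/
@[ext]
structure TorusPoint {F : Type*} [CommRing F] (d : F) (R : Type*) [CommRing R] [Algebra F R] where
  x : R
  y : R
  eq_one : x ^ 2 - algebraMap F R d * y ^ 2 = 1

namespace TorusPoint

section Group

variable {F : Type*} [CommRing F] {d : F} {R S : Type*} [CommRing R] [CommRing S]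
  [Algebra F R] [Algebra F S]

instance : Zero (TorusPoint d R) := ⟨⟨1, 0, by ring⟩⟩

/-- The group law `(x₁, y₁) * (x₂, y₂) = (x₁ x₂ + d y₁ y₂, x₁ y₂ + x₂ y₁)`, written additively. -/
instance : Add (TorusPoint d R) :=
  ⟨fun P Q => ⟨P.x * Q.x + algebraMap F R d * P.y * Q.y, P.x * Q.y + Q.x * P.y, by
    linear_combination (Q.x ^ 2 - algebraMap F R d * Q.y ^ 2) * P.eq_one + Q.eq_one⟩⟩

instance : Neg (TorusPoint d R) := ⟨fun P => ⟨P.x, -P.y, by linear_combination P.eq_one⟩⟩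

@[simp] theorem zero_x : (0 : TorusPoint d R).x = 1 := rfl
@[simp] theorem zero_y : (0 : TorusPoint d R).y = 0 := rfl
@[simp] theorem add_x (P Q : TorusPoint d R) :
    (P + Q).x = P.x * Q.x + algebraMap F R d * P.y * Q.y := rfl
@[simp] theorem add_y (P Q : TorusPoint d R) : (P + Q).y = P.x * Q.y + Q.x * P.y := rfl
@[simp] theorem neg_x (P : TorusPoint d R) : (-P).x = P.x := rfl
@[simp] theorem neg_y (P : TorusPoint d R) : (-P).y = -P.y := rfl

instance : AddCommGroup (TorusPoint d R) where
  add_assoc P Q T := by ext <;> simp <;> ring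
  zero_add P := by ext <;> simp
  add_zero P := by ext <;> simp
  add_comm P Q := by ext <;> simp <;> ring
  neg_add_cancel P := by
    ext
    · simp only [add_x, neg_x, neg_y, zero_x]; linear_combination P.eq_one
    · simp only [add_y, neg_x, neg_y, zero_y]; ring
  nsmul := nsmulRec
  zsmul := zsmulRec

/-- The homomorphism `A(R) → A(S)` induced by a morphism of `F`-algebras `R → S`. -/
def map (f : R →ₐ[F] S) : TorusPoint d R →+ TorusPoint d S where
  toFun P := ⟨f P.x, f P.y, by
    rw [← f.commutes, ← map_pow, ← map_pow, ← map_mul, ← map_sub, P.eq_one, map_one]⟩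
  map_zero' := by ext <;> simp
  map_add' P Q := by ext <;> simp

@[simp] theorem map_x (f : R →ₐ[F] S) (P : TorusPoint d R) : (map f P).x = f P.x := rfl
@[simp] theorem map_y (f : R →ₐ[F] S) (P : TorusPoint d R) : (map f P).y = f P.y := rfl

end Group

noncomputable section Galois

variable {F : Type*} [Field F] (d : F) (ℓ : ℕ)

/-- The field `F(P)` generated over `F` by the coordinates of `P ∈ A(F^sep)`. -/
def fieldOf {d : F} (P : TorusPoint d (SeparableClosure F)) :
    IntermediateField F (SeparableClosure F) :=
  IntermediateField.adjoin F {P.x, P.y}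

/-- The field `F(A[m])` generated over `F` by the coordinates of all points of `A[m]`. -/
def torsionField (m : ℕ) : IntermediateField F (SeparableClosure F) :=
  ⨆ P ∈ {P : TorusPoint d (SeparableClosure F) | m • P = 0}, fieldOf P

/-- The field `T_∞ = ⋃ n, F(A[ℓ ^ n])`. -/
def torsionFieldInf : IntermediateField F (SeparableClosure F) :=
  ⨆ n : ℕ, torsionField d (ℓ ^ n)

/-- The Tate module `T_ℓ(A) = lim A[ℓ ^ n]` of compatible sequences `t n ∈ A[ℓ ^ n]`, the
transition maps being multiplication by `ℓ`. -/
def tateModule : AddSubgroup (ℕ → TorusPoint d (SeparableClosure F)) where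
  carrier := {t | ∀ n, ℓ ^ n • t n = 0 ∧ ℓ • t (n + 1) = t n}
  zero_mem' n := by simp
  add_mem' {s t} hs ht n := by simp [smul_add, hs n, ht n]
  neg_mem' {t} ht n := by simp [smul_neg, ht n]

variable {d} in
/-- The action of `σ ∈ Gal(F^sep/F)` on `A(F^sep)`. -/
abbrev galMap (σ : Gal(SeparableClosure F/F)) :
    TorusPoint d (SeparableClosure F) →+ TorusPoint d (SeparableClosure F) :=
  map (σ : SeparableClosure F →ₐ[F] SeparableClosure F)

/-- The action of `σ ∈ Gal(F^sep/F)` on `T_ℓ(A)`. -/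
def tateMap (σ : Gal(SeparableClosure F/F)) : tateModule d ℓ →+ tateModule d ℓ where
  toFun t := ⟨fun n => galMap σ (t.1 n), fun n => by
    rw [← map_nsmul, ← map_nsmul, (t.2 n).1, (t.2 n).2]; simp⟩
  map_zero' := by ext : 2; simp
  map_add' s t := by ext : 2; simp

/-- The `ℓ`-adic representation `ρ : Gal(F^sep/F) → Aut(T_ℓ(A))`. -/
def adicRep : Gal(SeparableClosure F/F) →* Multiplicative (AddAut (tateModule d ℓ)) where
  toFun σ := Multiplicative.ofAdd
    { tateMap d ℓ σ with
      invFun := tateMap d ℓ σ⁻¹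
      left_inv := fun t => by
        refine Subtype.ext (funext fun n => TorusPoint.ext ?_ ?_)
        · exact σ.symm_apply_apply _
        · exact σ.symm_apply_apply _
      right_inv := fun t => by
        refine Subtype.ext (funext fun n => TorusPoint.ext ?_ ?_)
        · exact σ.apply_symm_apply _
        · exact σ.apply_symm_apply _ }
  map_one' := rfl
  map_mul' _ _ := rfl

variable {d}

/-- A choice of points `β₀ = α, β₁, β₂, …` of `A(F^sep)` with `ℓ β_{n+1} = β_n`. -/
structure DivisionSequence (α : TorusPoint d F) where
  β : ℕ → TorusPoint d (SeparableClosure F)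
  zero : β 0 = map (Algebra.ofId F (SeparableClosure F)) α
  smul_succ : ∀ n, ℓ • β (n + 1) = β n

theorem galMap_eq_self_of_mem {σ : Gal(SeparableClosure F/F)}
    (hσ : σ ∈ (torsionFieldInf d ℓ).fixingSubgroup) {n : ℕ}
    {P : TorusPoint d (SeparableClosure F)} (hP : ℓ ^ n • P = 0) : galMap σ P = P := by
  have h : fieldOf P ≤ torsionFieldInf d ℓ :=
    (le_iSup₂_of_le (f := fun (Q : TorusPoint d (SeparableClosure F))
      (_ : Q ∈ {Q : TorusPoint d (SeparableClosure F) | ℓ ^ n • Q = 0}) => fieldOf Q)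
      P hP le_rfl).trans (le_iSup (fun n => torsionField d (ℓ ^ n)) n)
  rw [IntermediateField.mem_fixingSubgroup_iff] at hσ
  ext
  · exact congrArg _ (hσ P.x (h (IntermediateField.subset_adjoin F _ (by simp))))
  · exact congrArg _ (hσ P.y (h (IntermediateField.subset_adjoin F _ (by simp))))

variable {ℓ}

theorem DivisionSequence.pow_smul {α : TorusPoint d F} (b : DivisionSequence ℓ α) (n : ℕ) :
    ℓ ^ n • b.β n = b.β 0 := by
  induction n with
  | zero => simp
  | succ n ih => rw [pow_succ, mul_smul, b.smul_succ, ih]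

/-- The element `(σ(β_n) - β_n)_n` of `T_ℓ(A)`. -/
def DivisionSequence.cocycle {α : TorusPoint d F} (b : DivisionSequence ℓ α)
    (σ : Gal(SeparableClosure F/F)) : tateModule d ℓ :=
  ⟨fun n => galMap σ (b.β n) - b.β n, fun n => by
    constructor
    · rw [smul_sub, ← map_nsmul, b.pow_smul, b.zero, sub_eq_zero]
      exact TorusPoint.ext (σ.commutes α.x) (σ.commutes α.y)
    · rw [smul_sub, ← map_nsmul, b.smul_succ]⟩

/-- The Kummer map `κ : Gal(F^sep/T_∞) → T_ℓ(A)`, `κ(σ) = (σ(β_n) - β_n)_n`. -/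
def DivisionSequence.kummer {α : TorusPoint d F} (b : DivisionSequence ℓ α) :
    (torsionFieldInf d ℓ).fixingSubgroup →* Multiplicative (tateModule d ℓ) where
  toFun σ := Multiplicative.ofAdd (b.cocycle σ.1)
  map_one' := by
    refine congrArg Multiplicative.ofAdd (Subtype.ext (funext fun n => ?_))
    exact sub_eq_zero.2 rfl
  map_mul' σ τ := by
    refine congrArg Multiplicative.ofAdd (Subtype.ext (funext fun n => ?_))
    have h := galMap_eq_self_of_mem ℓ σ.2 ((b.cocycle τ.1).2 n).1
    change galMap σ.1 (galMap τ.1 (b.β n)) - b.β n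
      = (galMap σ.1 (b.β n) - b.β n) + (galMap τ.1 (b.β n) - b.β n)
    change galMap σ.1 (galMap τ.1 (b.β n) - b.β n) = galMap τ.1 (b.β n) - b.β n at h
    rw [map_sub] at h
    rw [← h]
    abel

end Galois

end TorusPoint

/-!
Write `G = Gal(F^sep/F)`, `G_∞ = Gal(F^sep/T_∞)` and `c(σ) = σ(β₁) - β₁ ∈ A[ℓ]`.

Over `F^sep` the torus is isomorphic to the multiplicative group (`unitsEquiv`), so it is
`ℓ`-divisible with `A[ℓ ^ n]` cyclic of order `ℓ ^ n`, and any `t ∈ T_ℓ(A)` with nonzero component in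
`A[ℓ]` generates the Tate module. As `G_∞` is compact, the image of `κ` is closed, so `κ` is
surjective as soon as some `σ ∈ G_∞` moves `β₁` (`DivisionSequence.kummer_surjective`). Conversely,
if `κ` is surjective then `β₁` is moved by `G_∞`, whereas `α ∈ ℓ A(F)` or `F(β₁) ⊆ F(A[8])` would
force `β₁` to have coordinates in `T_∞`.

It remains to see what it means that `G_∞` fixes `β₁`. In that case `σ(β₁)` depends only on the
action of `σ` on the Tate module (`galMap_eq_of_forall_tateModule`), so `c` is a cocycle on the image
of the `ℓ`-adic representation.

* If `ℓ` is odd, choose `g` acting as `-1`. It is central in the image, and comparing `c(gσ)` with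
  `c(σg)` gives `2 c(σ) = c(g) - σ c(g)`. Since `2` is invertible on `A[ℓ]`, the cocycle `c` is a
  coboundary, so `β₁` can be moved by a point of `A[ℓ]` into `A(F)`, and `α ∈ ℓ A(F)`
  (`DivisionSequence.exists_nsmul_eq_of_odd`).
* If `ℓ = 2`, then `G` acts trivially on `A[2]` and `c` is a homomorphism to a group of order two. An
  automorphism fixing `A[8]` acts on the Tate module by an element of `1 + 8 ℤ₂`, which is the
  square of a unit by Hensel's lemma; as the representation is surjective, the automorphism acts as
  `τ ^ 2` for some `τ ∈ G`, so `c` vanishes on it. By Galois theory `F(β₁) ⊆ F(A[8])`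
  (`DivisionSequence.fieldOf_le_torsionField_eight`).
-/

/-! ### `ℓ`-adic integers -/

/-- A `2`-adic integer congruent to `1` modulo `8` is the square of a unit. -/
theorem PadicInt.exists_units_sq_eq (u : ℤ_[2]) (hu : toZModPow 3 u = 1) :
    ∃ v : ℤ_[2]ˣ, (v : ℤ_[2]) ^ 2 = u := by
  have hmem : (1 : ℤ_[2]) - u ∈ Ideal.span {((2 : ℕ) : ℤ_[2]) ^ 3} := by
    rw [← PadicInt.ker_toZModPow, RingHom.mem_ker, map_sub, hu, map_one, sub_self]
  have hle := (PadicInt.norm_le_pow_iff_mem_span_pow _ _).2 hmem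
  have hnorm2 : ‖(2 : ℤ_[2])‖ = 2⁻¹ := by simpa using PadicInt.norm_p (p := 2)
  -- For `X ^ 2 - u` at `1`, Hensel's condition is `‖1 - u‖ ≤ 1 / 8 < 1 / 4 = ‖2‖ ^ 2`.
  obtain ⟨z, hz, -, hz', -⟩ := hensels_lemma
    (p := 2) (F := (Polynomial.X ^ 2 - Polynomial.C u : Polynomial ℤ_[2])) (a := 1) (by
      simp only [Nat.cast_ofNat, zpow_neg] at hle
      simp [one_add_one_eq_two, hnorm2]
      refine hle.trans_lt ?_
      norm_num)
  -- The derivatives at `z` and `1` have the same norm, that is, `‖2 * z‖ = ‖2‖`.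
  have hz1 : ‖z‖ = 1 := by simpa [hnorm2] using hz'
  obtain ⟨v, rfl⟩ := PadicInt.isUnit_iff.2 hz1
  exact ⟨v, by simpa [sub_eq_zero] using hz⟩

/-- On an element killed by `ℓ ^ n`, the residue modulo `ℓ ^ n` of an `ℓ`-adic integer acts as any
natural number congruent to it. -/
theorem val_toZModPow_nsmul_eq {ℓ : ℕ} [Fact ℓ.Prime] {G : Type*} [AddMonoid G] {n m : ℕ}
    {z : ℤ_[ℓ]} (hz : PadicInt.toZModPow n z = (m : ZMod (ℓ ^ n))) {P : G} (hP : ℓ ^ n • P = 0) :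
    (PadicInt.toZModPow n z).val • P = m • P := by
  rw [hz, ZMod.val_natCast, ← nsmul_eq_mod_nsmul m hP]

namespace TorusPoint

/-! ### Splitting of the torus -/

section SplitTorus

variable {F K : Type*} [Field F] [Field K] [Algebra F K] {d : F}

/-- Over a field containing a nonzero square root `δ` of `d`, the torus is split by
`(x, y) ↦ x + δ y`. -/
def unitsEquiv (h2 : (2 : K) ≠ 0) {δ : K} (hδ : δ ^ 2 = algebraMap F K d) (hδ0 : δ ≠ 0) :
    TorusPoint d K ≃+ Additive Kˣ where
  toFun P := Additive.ofMul
    ⟨P.x + δ * P.y, P.x - δ * P.y, by linear_combination P.eq_one - P.y ^ 2 * hδ,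
      by linear_combination P.eq_one - P.y ^ 2 * hδ⟩
  invFun u :=
    ⟨((u.toMul : K) + (u.toMul⁻¹ : Kˣ)) / 2, ((u.toMul : K) - (u.toMul⁻¹ : Kˣ)) / (2 * δ), by
      have h := u.toMul.mul_inv
      rw [← hδ]
      field_simp
      linear_combination 4 * h⟩
  left_inv P := by
    ext
    · simp [Units.inv_mk]; field_simp; ring
    · simp [Units.inv_mk]; field_simp; ring
  right_inv u := by
    apply Additive.toMul.injective
    ext
    simp
    field_simp
    ring
  map_add' P Q := by
    apply Additive.toMul.injective
    ext
    simp [← hδ]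
    ring

end SplitTorus

/-! ### Divisibility and torsion over a separably closed field -/

section Torsion

variable {F K : Type*} [Field F] [Field K] [Algebra F K] [IsSepClosed K] {d : F} {ℓ : ℕ}

theorem exists_unitsEquiv (h2 : (2 : K) ≠ 0) (hd : d ≠ 0) :
    Nonempty (TorusPoint d K ≃+ Additive Kˣ) := by
  have : NeZero ((2 : ℕ) : K) := ⟨by simpa using h2⟩
  obtain ⟨δ, hδ⟩ := IsSepClosed.exists_pow_nat_eq (algebraMap F K d) 2
  refine ⟨unitsEquiv h2 hδ ?_⟩
  rintro rfl
  exact (map_ne_zero (algebraMap F K)).2 hd (by simpa using hδ.symm)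

/-- `A(K)` is `ℓ`-divisible, because `Kˣ` is. -/
theorem exists_nsmul_eq (h2 : (2 : K) ≠ 0) (hℓK : (ℓ : K) ≠ 0) (hd : d ≠ 0)
    (P : TorusPoint d K) : ∃ Q, ℓ • Q = P := by
  obtain ⟨e⟩ := exists_unitsEquiv h2 hd
  have : NeZero (ℓ : K) := ⟨hℓK⟩
  obtain ⟨z, hz⟩ := IsSepClosed.exists_pow_nat_eq ((e P).toMul : K) ℓ
  have hℓ0 : ℓ ≠ 0 := by rintro rfl; simp at hℓK
  have hz0 : z ≠ 0 := by
    rintro rfl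
    rw [zero_pow hℓ0] at hz
    exact (e P).toMul.ne_zero hz.symm
  refine ⟨e.symm (Additive.ofMul (Units.mk0 z hz0)), e.injective ?_⟩
  rw [map_nsmul, e.apply_symm_apply]
  apply Additive.toMul.injective
  ext
  simpa using hz

theorem exists_ne_zero_nsmul_eq_zero (h2 : (2 : K) ≠ 0) (hℓ : ℓ.Prime) (hℓK : (ℓ : K) ≠ 0)
    (hd : d ≠ 0) : ∃ P : TorusPoint d K, P ≠ 0 ∧ ℓ • P = 0 := by
  obtain ⟨e⟩ := exists_unitsEquiv h2 hd
  have : NeZero (ℓ : K) := ⟨hℓK⟩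
  obtain ⟨ζ, hζ⟩ := HasEnoughRootsOfUnity.exists_primitiveRoot K ℓ
  have hζ0 : ζ ≠ 0 := hζ.ne_zero hℓ.ne_zero
  refine ⟨e.symm (Additive.ofMul (Units.mk0 ζ hζ0)), ?_, e.injective ?_⟩
  · rw [Ne, EmbeddingLike.map_eq_zero_iff, ofMul_eq_zero]
    intro h
    exact hζ.ne_one hℓ.one_lt (by simpa using congrArg Units.val h)
  · rw [map_nsmul, e.apply_symm_apply, map_zero]
    apply Additive.toMul.injective
    ext
    simpa using hζ.pow_eq_one

/-- A point of exact order `ℓ ^ (n + 1)` generates `A[ℓ ^ (n + 1)]`. -/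
theorem exists_eq_nsmul (h2 : (2 : K) ≠ 0) (hℓ : ℓ.Prime) (hd : d ≠ 0) {n : ℕ}
    {P Q : TorusPoint d K} (hP : ℓ ^ (n + 1) • P = 0) (hP' : ℓ ^ n • P ≠ 0)
    (hQ : ℓ ^ (n + 1) • Q = 0) : ∃ k : ℕ, Q = k • P := by
  obtain ⟨e⟩ := exists_unitsEquiv h2 hd
  have := Fact.mk hℓ
  have hpow (R : TorusPoint d K) (m : ℕ) :
      (e R).toMul ^ m = 1 ↔ m • R = 0 := by
    rw [← toMul_nsmul, ← map_nsmul, toMul_eq_one, EmbeddingLike.map_eq_zero_iff]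
  have hord : IsPrimitiveRoot (e P).toMul (ℓ ^ (n + 1)) := by
    rw [IsPrimitiveRoot.iff_orderOf]
    exact orderOf_eq_prime_pow (by rwa [hpow]) (by rwa [hpow])
  have : NeZero (ℓ ^ (n + 1)) := ⟨pow_ne_zero _ hℓ.ne_zero⟩
  obtain ⟨k, -, hk⟩ := (IsPrimitiveRoot.coe_units_iff.2 hord).eq_pow_of_pow_eq_one
    (ξ := ((e Q).toMul : K)) (by rw [← Units.val_pow_eq_pow_val, (hpow _ _).2 hQ, Units.val_one])
  refine ⟨k, e.injective ?_⟩
  rw [map_nsmul]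
  apply Additive.toMul.injective
  ext
  simpa using hk.symm

end Torsion

/-! ### Galois action on points -/

section Galois

variable {F : Type*} [Field F] {d : F} {ℓ : ℕ}

theorem mem_fixingSubgroup_fieldOf {σ : Gal(SeparableClosure F/F)}
    {P : TorusPoint d (SeparableClosure F)} :
    σ ∈ (fieldOf P).fixingSubgroup ↔ galMap σ P = P := by
  rw [IntermediateField.mem_fixingSubgroup_iff, TorusPoint.ext_iff]
  exact (IntermediateField.forall_mem_adjoin_smul_eq_self_iff F σ).trans (by simp)

theorem mem_fixingSubgroup_torsionField {σ : Gal(SeparableClosure F/F)} {m : ℕ} :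
    σ ∈ (torsionField d m).fixingSubgroup ↔
      ∀ P : TorusPoint d (SeparableClosure F), m • P = 0 → galMap σ P = P := by
  simp only [← mem_fixingSubgroup_fieldOf, ← Subgroup.zpowers_le, ← IntermediateField.le_iff_le,
    torsionField, iSup₂_le_iff, Set.mem_ofPred_eq]

theorem mem_fixingSubgroup_torsionFieldInf {σ : Gal(SeparableClosure F/F)} :
    σ ∈ (torsionFieldInf d ℓ).fixingSubgroup ↔
      ∀ n, ∀ P : TorusPoint d (SeparableClosure F), ℓ ^ n • P = 0 → galMap σ P = P := by
  simp only [← mem_fixingSubgroup_torsionField]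
  simp only [← Subgroup.zpowers_le, ← IntermediateField.le_iff_le, torsionFieldInf, iSup_le_iff]

theorem fieldOf_le_of_fixed {P : TorusPoint d (SeparableClosure F)}
    {E : IntermediateField F (SeparableClosure F)}
    (h : ∀ σ ∈ E.fixingSubgroup, galMap σ P = P) : fieldOf P ≤ E := by
  rw [← InfiniteGalois.fixedField_fixingSubgroup E, IntermediateField.le_iff_le]
  exact fun σ hσ => mem_fixingSubgroup_fieldOf.2 (h σ hσ)

/-- A point of `A(F^sep)` fixed by the Galois group is defined over `F`. -/
theorem exists_map_eq_of_fixed {P : TorusPoint d (SeparableClosure F)}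
    (h : ∀ σ : Gal(SeparableClosure F/F), galMap σ P = P) :
    ∃ Q : TorusPoint d F, map (Algebra.ofId F (SeparableClosure F)) Q = P := by
  obtain ⟨x, hx⟩ := (InfiniteGalois.mem_range_algebraMap_iff_fixed P.x).2
    fun σ => congrArg TorusPoint.x (h σ)
  obtain ⟨y, hy⟩ := (InfiniteGalois.mem_range_algebraMap_iff_fixed P.y).2
    fun σ => congrArg TorusPoint.y (h σ)
  refine ⟨⟨x, y, (algebraMap F (SeparableClosure F)).injective ?_⟩, TorusPoint.ext hx hy⟩
  simpa [hx, hy] using P.eq_one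

theorem map_ofId_injective :
    Function.Injective (map (d := d) (Algebra.ofId F (SeparableClosure F))) := fun _ _ h =>
  TorusPoint.ext ((algebraMap F (SeparableClosure F)).injective (congrArg TorusPoint.x h))
    ((algebraMap F (SeparableClosure F)).injective (congrArg TorusPoint.y h))

theorem galMap_map_ofId (σ : Gal(SeparableClosure F/F)) (Q : TorusPoint d F) :
    galMap σ (map (Algebra.ofId F (SeparableClosure F)) Q)
      = map (Algebra.ofId F (SeparableClosure F)) Q :=
  TorusPoint.ext (σ.commutes Q.x) (σ.commutes Q.y)

theorem galMap_mul (σ τ : Gal(SeparableClosure F/F)) (P : TorusPoint d (SeparableClosure F)) :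
    galMap (σ * τ) P = galMap σ (galMap τ P) := rfl

theorem galMap_inv_eq_iff {σ : Gal(SeparableClosure F/F)}
    {P Q : TorusPoint d (SeparableClosure F)} : galMap σ⁻¹ P = Q ↔ P = galMap σ Q := by
  have h (τ : Gal(SeparableClosure F/F)) (R : TorusPoint d (SeparableClosure F)) :
      galMap τ (galMap τ⁻¹ R) = R := by rw [← galMap_mul, mul_inv_cancel]; rfl
  constructor
  · rintro rfl
    exact (h σ P).symm
  · rintro rfl
    simpa using h σ⁻¹ Q

theorem isClosed_setOf_galMap_eq (P Q : TorusPoint d (SeparableClosure F)) :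
    IsClosed {σ : Gal(SeparableClosure F/F) | galMap σ P = Q} := by
  rcases Set.eq_empty_or_nonempty {σ : Gal(SeparableClosure F/F) | galMap σ P = Q} with h | ⟨τ, hτ⟩
  · rw [h]
    exact isClosed_empty
  -- The set is a left coset of the stabiliser of `P`.
  convert! (InfiniteGalois.fixingSubgroup_isClosed (fieldOf P)).preimage
    (continuous_const_mul τ⁻¹) using 1
  ext σ
  rw [Set.mem_preimage, SetLike.mem_coe, mem_fixingSubgroup_fieldOf, galMap_mul,
    galMap_inv_eq_iff, hτ, Set.mem_ofPred_eq]

/-- The points of order dividing `2` are `(±1, 0)`, hence rational. -/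
theorem galMap_eq_of_two_nsmul_eq_zero (h2 : (2 : SeparableClosure F) ≠ 0) (hd : d ≠ 0)
    (σ : Gal(SeparableClosure F/F)) {P : TorusPoint d (SeparableClosure F)} (hP : 2 • P = 0) :
    galMap σ P = P := by
  have hd' : algebraMap F (SeparableClosure F) d ≠ 0 := (map_ne_zero _).2 hd
  have hx : P.x * P.x + algebraMap F (SeparableClosure F) d * P.y * P.y = 1 := by
    simpa [two_nsmul] using congrArg TorusPoint.x hP
  have hy : P.y = 0 := by
    have h : 2 * algebraMap F (SeparableClosure F) d * P.y ^ 2 = 0 := by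
      linear_combination hx - P.eq_one
    simpa [h2, hd'] using h
  have hx' : P.x = 1 ∨ P.x = -1 :=
    mul_self_eq_one_iff.1 (by simpa [hy] using hx)
  refine TorusPoint.ext ?_ ?_
  · rcases hx' with h | h <;> simp [h]
  · simp [hy]

end Galois

/-! ### Tate module -/

section TateModule

variable {F : Type*} [Field F] {d : F} {ℓ : ℕ}

theorem tateModule_zero (t : tateModule d ℓ) : t.1 0 = 0 := by simpa using (t.2 0).1

theorem tateModule_pow_nsmul (t : tateModule d ℓ) (m n : ℕ) : ℓ ^ n • t.1 (m + n) = t.1 m := by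
  induction n with
  | zero => simp
  | succ n ih => rw [pow_succ, mul_smul, ← add_assoc, (t.2 _).2, ih]

/-- Dividing a nonzero point of `A[ℓ]` repeatedly by `ℓ` gives an element of the Tate module that does
not lie in `ℓ T_ℓ(A)`. -/
theorem exists_tateModule_ne_zero (h2 : (2 : SeparableClosure F) ≠ 0) (hℓ : ℓ.Prime)
    (hℓF : (ℓ : SeparableClosure F) ≠ 0) (hd : d ≠ 0) : ∃ t : tateModule d ℓ, t.1 1 ≠ 0 := by
  obtain ⟨P, hP0, hP⟩ := exists_ne_zero_nsmul_eq_zero (d := d) h2 hℓ hℓF hd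
  choose f hf using exists_nsmul_eq (d := d) h2 hℓF hd
  have hrec (n : ℕ) : ℓ ^ n • f^[n] P = P := by
    induction n with
    | zero => simp
    | succ n ih => rw [pow_succ, mul_smul, Function.iterate_succ_apply', hf, ih]
  refine ⟨⟨fun n => Nat.casesOn n 0 fun n => f^[n] P, fun n => ?_⟩, hP0⟩
  cases n with
  | zero => exact ⟨smul_zero _, hP⟩
  | succ n =>
    refine ⟨?_, ?_⟩
    · change ℓ ^ (n + 1) • f^[n] P = 0
      rw [pow_succ', mul_smul, hrec, hP]
    · change ℓ • f^[n + 1] P = f^[n] P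
      rw [Function.iterate_succ_apply', hf]

/-- An element of the Tate module outside `ℓ T_ℓ(A)` generates each `A[ℓ ^ n]`. -/
theorem exists_eq_nsmul_tateModule (h2 : (2 : SeparableClosure F) ≠ 0) (hℓ : ℓ.Prime)
    (hd : d ≠ 0) {t : tateModule d ℓ} (ht : t.1 1 ≠ 0) {n : ℕ}
    {P : TorusPoint d (SeparableClosure F)} (hP : ℓ ^ n • P = 0) : ∃ k : ℕ, P = k • t.1 n := by
  cases n with
  | zero => exact ⟨0, by simpa using hP⟩
  | succ n =>
    refine exists_eq_nsmul h2 hℓ hd (t.2 _).1 ?_ hP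
    rwa [add_comm, tateModule_pow_nsmul]

theorem addOrderOf_tateModule (hℓ : ℓ.Prime) {t : tateModule d ℓ} (ht : t.1 1 ≠ 0) (n : ℕ) :
    addOrderOf (t.1 n) = ℓ ^ n := by
  cases n with
  | zero => simp [tateModule_zero]
  | succ n =>
    have := Fact.mk hℓ
    refine addOrderOf_eq_prime_pow ?_ (t.2 _).1
    rwa [add_comm, tateModule_pow_nsmul]

theorem mem_fixingSubgroup_torsionFieldInf_of_tateModule (h2 : (2 : SeparableClosure F) ≠ 0)
    (hℓ : ℓ.Prime) (hd : d ≠ 0) {t : tateModule d ℓ} (ht : t.1 1 ≠ 0)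
    {σ : Gal(SeparableClosure F/F)} (hσ : ∀ n, galMap σ (t.1 n) = t.1 n) :
    σ ∈ (torsionFieldInf d ℓ).fixingSubgroup := by
  refine mem_fixingSubgroup_torsionFieldInf.2 fun n P hP => ?_
  obtain ⟨k, rfl⟩ := exists_eq_nsmul_tateModule h2 hℓ hd ht hP
  rw [map_nsmul, hσ]

variable [Fact ℓ.Prime]

/-- Multiplication by an `ℓ`-adic integer on the Tate module: on `A[ℓ ^ n]` it is multiplication by
the least natural number congruent to it modulo `ℓ ^ n`. -/
noncomputable def padicMul (z : ℤ_[ℓ]) : tateModule d ℓ →+ tateModule d ℓ where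
  toFun t := ⟨fun n => (PadicInt.toZModPow n z).val • t.1 n, fun n => by
    refine ⟨by rw [smul_comm, (t.2 n).1, smul_zero], ?_⟩
    rw [smul_comm, (t.2 n).2]
    refine (val_toZModPow_nsmul_eq ?_ (t.2 n).1).symm
    rw [← PadicInt.cast_toZModPow n (n + 1) n.le_succ, ZMod.natCast_val]⟩
  map_zero' := by ext : 2; simp
  map_add' s t := by ext : 2; simp [smul_add]

theorem padicMul_apply (z : ℤ_[ℓ]) (t : tateModule d ℓ) (n : ℕ) :
    (padicMul z t).1 n = (PadicInt.toZModPow n z).val • t.1 n := rfl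

theorem padicMul_padicMul (z w : ℤ_[ℓ]) (t : tateModule d ℓ) :
    padicMul z (padicMul w t) = padicMul (z * w) t := by
  refine Subtype.ext (funext fun n => ?_)
  simp only [padicMul_apply]
  rw [← mul_smul]
  exact (val_toZModPow_nsmul_eq (by simp) (t.2 n).1).symm

theorem padicMul_one (t : tateModule d ℓ) : padicMul 1 t = t := by
  refine Subtype.ext (funext fun n => ?_)
  rw [padicMul_apply, val_toZModPow_nsmul_eq (m := 1) (by simp) (t.2 n).1, one_smul]

/-- Multiplication by an `ℓ`-adic unit as an automorphism of the Tate module. -/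
noncomputable def padicUnitAut (v : ℤ_[ℓ]ˣ) : AddAut (tateModule d ℓ) :=
  { padicMul (v : ℤ_[ℓ]) with
    invFun := padicMul ((v⁻¹ : ℤ_[ℓ]ˣ) : ℤ_[ℓ])
    left_inv := fun t => by
      change padicMul _ (padicMul _ t) = t
      rw [padicMul_padicMul, Units.inv_mul, padicMul_one]
    right_inv := fun t => by
      change padicMul _ (padicMul _ t) = t
      rw [padicMul_padicMul, Units.mul_inv, padicMul_one] }

/-- An element outside `ℓ T_ℓ(A)` generates the Tate module over the `ℓ`-adic integers. -/
theorem exists_padicMul_eq (h2 : (2 : SeparableClosure F) ≠ 0)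
    (hd : d ≠ 0) {t : tateModule d ℓ} (ht : t.1 1 ≠ 0) (s : tateModule d ℓ) :
    ∃ u : ℤ_[ℓ], padicMul u t = s := by
  have hℓ : ℓ.Prime := Fact.out
  choose a ha using fun n => exists_eq_nsmul_tateModule h2 hℓ hd ht (s.2 n).1
  have hdvd (n : ℕ) : (ℓ : ℤ) ^ n ∣ (a (n + 1) : ℤ) - a n := by
    have h : a n • t.1 n = a (n + 1) • t.1 n := by
      rw [← ha, ← (s.2 n).2, ha, smul_comm, (t.2 n).2]
    rw [nsmul_eq_nsmul_iff_modEq, addOrderOf_tateModule hℓ ht, Nat.modEq_iff_dvd] at h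
    exact_mod_cast h
  obtain ⟨u, hu⟩ : ∃ u : ℤ_[ℓ], ∀ n, PadicInt.toZModPow n u = (a n : ZMod (ℓ ^ n)) :=
    ⟨_, fun n => (PadicInt.toZModPow_ofIntSeq_of_pow_dvd_sub (fun n => a n) ℓ hdvd n).trans
      (Int.cast_natCast _)⟩
  refine ⟨u, Subtype.ext (funext fun n => ?_)⟩
  rw [padicMul_apply, ha n]
  exact val_toZModPow_nsmul_eq (hu n) (t.2 n).1

end TateModule

/-! ### Kummer map -/

section Kummer

variable {F : Type*} [Field F] {d : F} {ℓ : ℕ}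

theorem adicRep_apply (σ : Gal(SeparableClosure F/F)) (t : tateModule d ℓ) (n : ℕ) :
    ((adicRep d ℓ σ).toAdd t).1 n = galMap σ (t.1 n) := rfl

/-- Two automorphisms that agree on a generator of the Tate module agree on every point that is
fixed by `Gal(F^sep/T_∞)`. -/
theorem galMap_eq_of_forall_tateModule (h2 : (2 : SeparableClosure F) ≠ 0) (hℓ : ℓ.Prime)
    (hd : d ≠ 0) {t : tateModule d ℓ} (ht : t.1 1 ≠ 0) {P : TorusPoint d (SeparableClosure F)}
    (hP : ∀ σ ∈ (torsionFieldInf d ℓ).fixingSubgroup, galMap σ P = P)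
    {σ τ : Gal(SeparableClosure F/F)} (h : ∀ n, galMap σ (t.1 n) = galMap τ (t.1 n)) :
    galMap σ P = galMap τ P := by
  have hmem := mem_fixingSubgroup_torsionFieldInf_of_tateModule h2 hℓ hd ht (σ := τ⁻¹ * σ)
    fun n => by rw [galMap_mul, galMap_inv_eq_iff, h]
  exact galMap_inv_eq_iff.1 (hP _ hmem)

theorem DivisionSequence.kummer_apply {α : TorusPoint d F} (b : DivisionSequence ℓ α)
    (σ : (torsionFieldInf d ℓ).fixingSubgroup) :
    b.kummer σ = Multiplicative.ofAdd (b.cocycle σ.1) := rfl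

theorem DivisionSequence.cocycle_apply {α : TorusPoint d F} (b : DivisionSequence ℓ α)
    (σ : Gal(SeparableClosure F/F)) (n : ℕ) :
    (b.cocycle σ).1 n = galMap σ (b.β n) - b.β n := rfl

theorem DivisionSequence.galMap_pow {α : TorusPoint d F} (b : DivisionSequence ℓ α)
    {σ : Gal(SeparableClosure F/F)} (hσ : σ ∈ (torsionFieldInf d ℓ).fixingSubgroup) (k n : ℕ) :
    galMap (σ ^ k) (b.β n) = b.β n + k • (b.cocycle σ).1 n := by
  induction k with
  | zero => rw [pow_zero, zero_smul, add_zero]; rfl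
  | succ k ih =>
    rw [pow_succ', galMap_mul, ih, map_add, map_nsmul,
      galMap_eq_self_of_mem ℓ hσ ((b.cocycle σ).2 n).1, succ_nsmul', ← add_assoc,
      cocycle_apply, add_sub_cancel]

/-- The image of the Kummer map is closed, so it is everything as soon as it contains an element
outside `ℓ T_ℓ(A)`. -/
theorem DivisionSequence.kummer_surjective (h2 : (2 : SeparableClosure F) ≠ 0) (hℓ : ℓ.Prime)
    (hd : d ≠ 0) {α : TorusPoint d F} (b : DivisionSequence ℓ α)
    {σ : Gal(SeparableClosure F/F)} (hσ : σ ∈ (torsionFieldInf d ℓ).fixingSubgroup)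
    (hne : galMap σ (b.β 1) ≠ b.β 1) : Function.Surjective b.kummer := by
  intro s
  let s' : tateModule d ℓ := s.toAdd
  -- `τ ∈ C n` means that `κ(τ)` and the target agree in level `n`.
  let C (n : ℕ) : Set Gal(SeparableClosure F/F) :=
    (torsionFieldInf d ℓ).fixingSubgroup ∩ {τ | galMap τ (b.β n) = b.β n + s'.1 n}
  have hclosed (n : ℕ) : IsClosed (C n) :=
    (InfiniteGalois.fixingSubgroup_isClosed _).inter (isClosed_setOf_galMap_eq _ _)
  have hnonempty (n : ℕ) : (C n).Nonempty := by
    obtain ⟨k, hk⟩ := exists_eq_nsmul_tateModule h2 hℓ hd (t := b.cocycle σ)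
      (sub_ne_zero.2 hne) (s'.2 n).1
    refine ⟨σ ^ k, pow_mem hσ k, ?_⟩
    rw [Set.mem_ofPred_eq, hk, b.galMap_pow hσ]
  have hanti (n : ℕ) : C (n + 1) ⊆ C n := fun τ hτ => by
    refine ⟨hτ.1, ?_⟩
    have h : galMap τ (b.β (n + 1)) = b.β (n + 1) + s'.1 (n + 1) := hτ.2
    change galMap τ (b.β n) = b.β n + s'.1 n
    rw [← b.smul_succ, ← (s'.2 n).2, map_nsmul, h, smul_add]
  obtain ⟨τ, hτ⟩ := IsCompact.nonempty_iInter_of_sequence_nonempty_isCompact_isClosed C hanti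
    hnonempty (hclosed 0).isCompact hclosed
  rw [Set.mem_iInter] at hτ
  refine ⟨⟨τ, (hτ 0).1⟩, ?_⟩
  rw [kummer_apply]
  refine congrArg Multiplicative.ofAdd (a₂ := s') (Subtype.ext (funext fun n => ?_))
  rw [cocycle_apply]
  exact sub_eq_iff_eq_add'.2 (hτ n).2

theorem DivisionSequence.nsmul_galMap_sub {α : TorusPoint d F} (b : DivisionSequence ℓ α)
    (σ : Gal(SeparableClosure F/F)) : ℓ • (galMap σ (b.β 1) - b.β 1) = 0 := by
  simpa only [pow_one, cocycle_apply] using ((b.cocycle σ).2 1).1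

/-- For odd `ℓ`, an automorphism acting as `-1` on the Tate module is central modulo
`Gal(F^sep/T_∞)`, so the class of `σ ↦ σ(β₁) - β₁` in `H¹(Gal(T_∞/F), A[ℓ])` is killed by `-2`. -/
theorem DivisionSequence.exists_nsmul_eq_of_odd (h2 : (2 : SeparableClosure F) ≠ 0)
    (hℓ : ℓ.Prime) (hodd : Odd ℓ) (hd : d ≠ 0) {t : tateModule d ℓ} (ht : t.1 1 ≠ 0)
    (hρ : Function.Surjective (adicRep d ℓ)) {α : TorusPoint d F} (b : DivisionSequence ℓ α)
    (hβ : ∀ σ ∈ (torsionFieldInf d ℓ).fixingSubgroup, galMap σ (b.β 1) = b.β 1) :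
    ∃ γ : TorusPoint d F, ℓ • γ = α := by
  obtain ⟨g, hg⟩ := hρ (Multiplicative.ofAdd (AddEquiv.neg (tateModule d ℓ)))
  have hgt (s : tateModule d ℓ) (n : ℕ) : galMap g (s.1 n) = -s.1 n := by
    rw [← adicRep_apply, hg]
    rfl
  obtain ⟨c, hc, hgc⟩ : ∃ c, ℓ • c = 0 ∧ galMap g (b.β 1) = b.β 1 + c :=
    ⟨_, b.nsmul_galMap_sub g, (add_sub_cancel _ _).symm⟩
  have key (σ : Gal(SeparableClosure F/F)) :
      2 • (galMap σ (b.β 1) - b.β 1) = c - galMap σ c := by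
    -- `g` commutes with `σ` on the Tate module.
    have hcomm : galMap (g * σ) (b.β 1) = galMap (σ * g) (b.β 1) :=
      galMap_eq_of_forall_tateModule h2 hℓ hd ht hβ fun n => by
        rw [galMap_mul, galMap_mul, hgt, map_neg]
        exact hgt (tateMap d ℓ σ t) n
    have hgs : galMap g (galMap σ (b.β 1) - b.β 1) = -(galMap σ (b.β 1) - b.β 1) :=
      hgt (b.cocycle σ) 1
    rw [galMap_mul, galMap_mul, hgc, map_add] at hcomm
    rw [map_sub, hcomm, hgc] at hgs
    rw [two_nsmul]
    generalize galMap σ (b.β 1) = P at hgs ⊢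
    generalize galMap σ c = c' at hgs ⊢
    refine sub_eq_zero.1 (Eq.trans ?_ (sub_eq_zero.2 hgs))
    abel
  obtain ⟨k, hk⟩ := hodd
  -- `k + 1` is the inverse of `2` modulo `ℓ`.
  have hinv {P : TorusPoint d (SeparableClosure F)} (hP : ℓ • P = 0) : (k + 1) • 2 • P = P := by
    rw [← mul_smul, show (k + 1) * 2 = ℓ + 1 by omega, succ_nsmul, hP, zero_add]
  obtain ⟨γ, hγ⟩ := exists_map_eq_of_fixed (P := b.β 1 + (k + 1) • c) fun σ => by
    have h : galMap σ (b.β 1) - b.β 1 = (k + 1) • c - (k + 1) • galMap σ c := by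
      rw [← smul_sub, ← key σ, hinv (b.nsmul_galMap_sub σ)]
    rw [map_add, map_nsmul, sub_eq_sub_iff_add_eq_add.1 h, add_comm]
  refine ⟨γ, map_ofId_injective ?_⟩
  rw [map_nsmul, hγ, smul_add, smul_comm, hc, smul_zero, add_zero, b.smul_succ, b.zero]

/-- An automorphism fixing `A[8]` acts on the `2`-adic Tate module as the square of another one,
since every element of `1 + 8 ℤ₂` is a square; and `σ ↦ σ(β₁) - β₁` is a homomorphism to a group
of order two. -/
theorem DivisionSequence.fieldOf_le_torsionField_eight (h2 : (2 : SeparableClosure F) ≠ 0)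
    (hd : d ≠ 0) {t : tateModule d 2} (ht : t.1 1 ≠ 0)
    (hρ : Function.Surjective (adicRep d 2)) {α : TorusPoint d F} (b : DivisionSequence 2 α)
    (hβ : ∀ σ ∈ (torsionFieldInf d 2).fixingSubgroup, galMap σ (b.β 1) = b.β 1) :
    fieldOf (b.β 1) ≤ torsionField d 8 := by
  refine fieldOf_le_of_fixed fun σ hσ => ?_
  rw [mem_fixingSubgroup_torsionField] at hσ
  obtain ⟨u, hu⟩ := exists_padicMul_eq h2 hd ht (tateMap d 2 σ t)
  have hu8 : PadicInt.toZModPow 3 u = 1 := by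
    have h : (PadicInt.toZModPow 3 u).val • t.1 3 = 1 • t.1 3 := by
      rw [← padicMul_apply, hu, one_smul]
      exact hσ _ (t.2 3).1
    rw [nsmul_eq_nsmul_iff_modEq, addOrderOf_tateModule Nat.prime_two ht,
      ← ZMod.natCast_eq_natCast_iff, ZMod.natCast_zmod_val, Nat.cast_one] at h
    exact h
  obtain ⟨v, rfl⟩ := PadicInt.exists_units_sq_eq u hu8
  obtain ⟨τ, hτ⟩ := hρ (Multiplicative.ofAdd (padicUnitAut v))
  have hτv (s : tateModule d 2) (n : ℕ) : galMap τ (s.1 n) = (padicMul (v : ℤ_[2]) s).1 n := by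
    rw [← adicRep_apply, hτ]
    rfl
  have hττ : galMap σ (b.β 1) = galMap (τ * τ) (b.β 1) :=
    galMap_eq_of_forall_tateModule h2 Nat.prime_two hd ht hβ fun n => by
      rw [galMap_mul, hτv, hτv, padicMul_padicMul, ← sq, hu]
      rfl
  have hc := b.nsmul_galMap_sub τ
  -- With `c(τ) = τ(β₁) - β₁` fixed by `τ` and killed by `2`, `c(τ * τ) = τ(c(τ)) + c(τ) = 0`.
  have hfix := galMap_eq_of_two_nsmul_eq_zero h2 hd τ hc
  rw [map_sub] at hfix
  rw [hττ, galMap_mul, ← sub_eq_zero, ← sub_add_sub_cancel _ (galMap τ (b.β 1)), hfix,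
    ← two_nsmul, hc]

end Kummer

end TorusPoint

/-! ### Surjectivity criterion -/

theorem mainTheorem10 {F : Type*} [Field F] (ℓ : ℕ) (hℓ : ℓ.Prime)
    (h2 : (2 : F) ≠ 0) (hℓF : (ℓ : F) ≠ 0) (d : F) (hd : d ≠ 0)
    (hρ : Function.Surjective (TorusPoint.adicRep d ℓ))
    (α : TorusPoint d F) (b : TorusPoint.DivisionSequence ℓ α) :
    Function.Surjective b.kummer ↔
      (¬ ∃ γ : TorusPoint d F, ℓ • γ = α) ∧
      (ℓ = 2 → ¬ TorusPoint.fieldOf (b.β 1) ≤ TorusPoint.torsionField d 8) := by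
  have hK {m : ℕ} (hm : (m : F) ≠ 0) : (m : SeparableClosure F) ≠ 0 := by
    rw [← map_natCast (algebraMap F (SeparableClosure F))]
    exact (map_ne_zero _).2 hm
  have h2K : (2 : SeparableClosure F) ≠ 0 := hK (m := 2) h2
  obtain ⟨t, ht⟩ := TorusPoint.exists_tateModule_ne_zero (d := d) h2K hℓ (hK hℓF) hd
  constructor
  · intro hsurj
    have hmove : ¬ ∀ σ ∈ (TorusPoint.torsionFieldInf d ℓ).fixingSubgroup,
        TorusPoint.galMap σ (b.β 1) = b.β 1 := by
      intro h
      obtain ⟨σ, hσ⟩ := hsurj (Multiplicative.ofAdd t)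
      rw [b.kummer_apply, Multiplicative.ofAdd.injective.eq_iff] at hσ
      have h1 : TorusPoint.galMap σ.1 (b.β 1) - b.β 1 = t.1 1 := by rw [← b.cocycle_apply, hσ]
      exact ht (by rw [← h1, h _ σ.2, sub_self])
    refine ⟨?_, ?_⟩
    · rintro ⟨γ, rfl⟩
      refine hmove fun σ hσ => ?_
      -- `β₁` differs from the rational point `γ` by a point of `A[ℓ]`.
      have h := TorusPoint.galMap_eq_self_of_mem ℓ hσ (n := 1)
        (P := b.β 1 - TorusPoint.map (Algebra.ofId F (SeparableClosure F)) γ)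
        (by rw [pow_one, smul_sub, b.smul_succ, b.zero, map_nsmul, sub_self])
      rw [map_sub, TorusPoint.galMap_map_ofId] at h
      exact sub_left_inj.1 h
    · rintro rfl hle
      refine hmove fun σ hσ => TorusPoint.mem_fixingSubgroup_fieldOf.1
        (IntermediateField.fixingSubgroup_antitone hle ?_)
      refine TorusPoint.mem_fixingSubgroup_torsionField.2 fun P hP =>
        TorusPoint.galMap_eq_self_of_mem 2 hσ (n := 3) ?_
      rwa [show 2 ^ 3 = 8 by norm_num]
  · rintro ⟨h1, h8⟩
    by_contra hsurj
    have hβ : ∀ σ ∈ (TorusPoint.torsionFieldInf d ℓ).fixingSubgroup,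
        TorusPoint.galMap σ (b.β 1) = b.β 1 := fun σ hσ => by
      by_contra hne
      exact hsurj (b.kummer_surjective h2K hℓ hd hσ hne)
    rcases hℓ.eq_two_or_odd' with rfl | hodd
    · exact h8 rfl (b.fieldOf_le_torsionField_eight h2K hd ht hρ hβ)
    · exact h1 (b.exists_nsmul_eq_of_odd h2K hℓ hodd hd ht hρ hβ)
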